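/- Let $n\ge 1$ be an integer. For an integer $n\times n$ matrix $A=(a_{ij})$ let $\mathcal H(A)$ be the multiplicative Weil height of the projective point with homogeneous coordinates $1$ and all the $a_{ij}$, i.e. $\mathcal H(A)=\max\{1,\max_{i,j}|a_{ij}|\}$. Call $A$ a root of the identity if $A^k=I_n$ for some integer $k>0$, and call a pair $(A,B)$ of nonsingular matrices multiplicatively dependent if $A^kB^l=I_n$ for some integers $k,l$, not both zero. Fix a real number $c>0$ and, for real $H$, let $\mathcal S^*_{n,2}(\mathbb Z;H)$ be the set of multiplicatively dependent pairs $(A,B)$ of symmetric, diagonalizable, nonsingular integer $n\times n$ matrices with $\mathcal H(A)\le cH$ and $\mathcal H(B)\le cH$ such that neither $A$ nor $B$ is a root of the identity. Then there are constants $C_1,C_2>0$, depending only on $n$ and $c$, such that for every real $H\ge 2$ the set $\mathcal S^*_{n,2}(\mathbb Z;H)$ is finite, $$\#\mathcal S^*_{n,2}(\mathbb Z;H)\le C_2\,H^{n^2}(\log H)^{2+n},$$ and, provided that $cH\ge 2$, $$C_1\,H^{(n^2+n)/2}\le \#\mathcal S^*_{n,2}(\mathbb Z;H).$$ -/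

import Mathlib

open Matrix

/-- The multiplicative (Weil) height of an integer matrix `A = (a i j)`: the height of the point of
projective space with homogeneous coordinates `1` and all the entries `a i j`. See
`matHeight_le_iff` for its elementary description. -/
noncomputable def matHeight {n : ℕ} (A : Matrix (Fin n) (Fin n) ℤ) : ℝ :=
  Height.mulHeight (fun o : Option (Fin n × Fin n) => o.elim (1 : ℚ) (fun p => (A p.1 p.2 : ℚ)))

/-- The height is at most `B` exactly if `1` and the absolute values of all entries are. -/
theorem matHeight_le_iff {n : ℕ} (A : Matrix (Fin n) (Fin n) ℤ) (B : ℝ) :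
    matHeight A ≤ B ↔ 1 ≤ B ∧ ∀ i j, |(A i j : ℝ)| ≤ B := by
  let x : Option (Fin n × Fin n) → ℤ := fun o => o.elim 1 (fun p => A p.1 p.2)
  have hgcd : Finset.univ.gcd x = 1 := by
    have h : Finset.univ.gcd x ∣ x none := Finset.gcd_dvd (Finset.mem_univ none)
    rw [← Finset.normalize_gcd]
    exact normalize_eq_one.mpr (isUnit_of_dvd_one h)
  have hx : (fun o : Option (Fin n × Fin n) =>
      o.elim (1 : ℚ) (fun p => (A p.1 p.2 : ℚ))) = ((↑) : ℤ → ℚ) ∘ x := by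
    funext o
    cases o <;> simp [x]
  have hbdd : BddAbove (Set.range fun o => |x o|) := Set.Finite.bddAbove (Set.finite_range _)
  rw [matHeight, hx, Rat.mulHeight_eq_max_abs_of_gcd_eq_one hgcd]
  constructor
  · intro h
    have key : ∀ o, |(x o : ℝ)| ≤ B := fun o =>
      le_trans (by exact_mod_cast le_ciSup hbdd o) h
    exact ⟨by simpa [x] using key none, fun i j => by simpa [x] using key (some (i, j))⟩
  · rintro ⟨h1, h2⟩
    obtain ⟨o, ho⟩ := exists_eq_ciSup_of_finite (f := fun o => |x o|)
    rw [← ho]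
    cases o with
    | none => simpa [x] using h1
    | some p => simpa [x] using h2 p.1 p.2

/-- `A` is diagonalizable (over the complex numbers). -/
def IsDiagonalizable {n : ℕ} (A : Matrix (Fin n) (Fin n) ℤ) : Prop :=
  ∃ (P : Matrix (Fin n) (Fin n) ℂ) (d : Fin n → ℂ), IsUnit P.det ∧
    A.map (Int.cast : ℤ → ℂ) = P * Matrix.diagonal d * P⁻¹

/-- `A` is a root of the identity matrix: `A ^ k = 1` for some positive integer `k`. -/
def IsRootOfIdentity {n : ℕ} (A : Matrix (Fin n) (Fin n) ℤ) : Prop :=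
  ∃ k : ℕ, 0 < k ∧ A ^ k = 1

/-- The (nonsingular) integer matrices `A`, `B` are multiplicatively dependent: `A ^ k * B ^ l = 1`
for some integers `k`, `l`, not both zero, the powers being taken over `ℚ`. -/
def MultDependent {n : ℕ} (A B : Matrix (Fin n) (Fin n) ℤ) : Prop :=
  ∃ k l : ℤ, (k ≠ 0 ∨ l ≠ 0) ∧
    A.map (Int.cast : ℤ → ℚ) ^ k * B.map (Int.cast : ℤ → ℚ) ^ l = 1

/-- The diagonalizable nonsingular integer `n × n` matrices of height at most `B`. -/
def diagMatrices (n : ℕ) (B : ℝ) : Set (Matrix (Fin n) (Fin n) ℤ) :=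
  {A | IsDiagonalizable A ∧ matHeight A ≤ B ∧ A.det ≠ 0}

/-- The multiplicatively dependent pairs of diagonalizable nonsingular integer `n × n` matrices of
height at most `B` in which neither component is a root of the identity matrix. -/
def diagPairs (n : ℕ) (B : ℝ) :
    Set (Matrix (Fin n) (Fin n) ℤ × Matrix (Fin n) (Fin n) ℤ) :=
  {p | p.1 ∈ diagMatrices n B ∧ p.2 ∈ diagMatrices n B ∧ MultDependent p.1 p.2 ∧
    ¬ IsRootOfIdentity p.1 ∧ ¬ IsRootOfIdentity p.2}

/-- The pairs in `diagPairs n B` both of whose components are symmetric. -/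
def symmPairs (n : ℕ) (B : ℝ) :
    Set (Matrix (Fin n) (Fin n) ℤ × Matrix (Fin n) (Fin n) ℤ) :=
  {p | p ∈ diagPairs n B ∧ p.1.IsSymm ∧ p.2.IsSymm}

/-! Upper bound. Fix `A`. Dependence, with `A` not a root of the identity, gives `B ^ m = A ^ a` or
`B ^ m * A ^ a = 1` with `m ≠ 0`. Squares of nonsingular symmetric matrices are positive definite,
where roots are unique, so `B * B` lies in the one-parameter group through `A * A`. Its position
there is pinned down by an integer with only `O(log H)` values: if `|det A| > 1`, the valuation of
`det B` at a prime dividing `det A` (`exists_index_of_not_isUnit_det`); if `det A = ±1`, the rounded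
parameter, because an integer matrix whose entries differ from those of the identity by less than 1
is the identity (`exists_index_of_isUnit_det`). Given `B * B`, the off-diagonal entries and the
diagonal signs recover `B` (`eq_of_mul_self_eq_of_offDiag_eq`). Hence each `A` has `O(H^(n(n-1)/2)
log H)` partners, and there are `O(H^(n(n+1)/2))` matrices `A`. The product `H^(n^2) log H` is
already sharper than the stated bound. Lower bound. The pairs `(A, A)` with `A` symmetric,
nonnegative and congruent to `2` times the identity modulo 3 suffice. -/

/-! ### Real symmetric matrices: unique positive roots and one-parameter groups. -/

section SpectralPowers

variable {ι : Type*} [Fintype ι] [DecidableEq ι]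

/-- A real symmetric matrix is orthogonally diagonalizable. -/
theorem exists_orthogonal_diagonal (A : Matrix ι ι ℝ) (hA : A.IsSymm) :
    ∃ (U : Matrix ι ι ℝ) (d : ι → ℝ), Uᵀ * U = 1 ∧ U * Uᵀ = 1 ∧ A = U * diagonal d * Uᵀ := by
  have hH : A.IsHermitian := by
    rw [Matrix.IsHermitian, conjTranspose_eq_transpose_of_trivial]
    exact hA
  refine ⟨hH.eigenvectorUnitary, hH.eigenvalues, ?_, ?_, ?_⟩
  · have h := Unitary.coe_star_mul_self hH.eigenvectorUnitary
    rwa [star_eq_conjTranspose, conjTranspose_eq_transpose_of_trivial] at h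
  · have h := Unitary.coe_mul_star_self hH.eigenvectorUnitary
    rwa [Unitary.coe_star, star_eq_conjTranspose, conjTranspose_eq_transpose_of_trivial] at h
  · have h := hH.spectral_theorem
    rw [Unitary.conjStarAlgAut_apply, star_eq_conjTranspose,
      conjTranspose_eq_transpose_of_trivial] at h
    exact h

theorem conj_diagonal_mul {U : Matrix ι ι ℝ} (hU : Uᵀ * U = 1) (d e : ι → ℝ) :
    (U * diagonal d * Uᵀ) * (U * diagonal e * Uᵀ) = U * diagonal (fun i => d i * e i) * Uᵀ := by
  calc (U * diagonal d * Uᵀ) * (U * diagonal e * Uᵀ)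
      = U * diagonal d * (Uᵀ * U) * diagonal e * Uᵀ := by simp only [Matrix.mul_assoc]
    _ = _ := by rw [hU, Matrix.mul_one, Matrix.mul_assoc U, diagonal_mul_diagonal]

theorem conj_diagonal_pow {U : Matrix ι ι ℝ} (hU : Uᵀ * U = 1) (hU' : U * Uᵀ = 1) (d : ι → ℝ)
    (m : ℕ) : (U * diagonal d * Uᵀ) ^ m = U * diagonal (fun i => d i ^ m) * Uᵀ := by
  induction m with
  | zero => simp [hU']
  | succ m ih => rw [pow_succ, ih, conj_diagonal_mul hU]; simp only [pow_succ]

/-- Squares of real symmetric matrices have unique positive semidefinite roots. -/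
theorem mul_self_eq_of_pow_eq {X Y : Matrix ι ι ℝ} (hX : X.IsSymm) (hY : Y.IsSymm) {m : ℕ}
    (hm : m ≠ 0) (h : (X * X) ^ m = (Y * Y) ^ m) : X * X = Y * Y := by
  obtain ⟨U, d, hU, hU', rfl⟩ := exists_orthogonal_diagonal X hX
  obtain ⟨V, e, hV, hV', rfl⟩ := exists_orthogonal_diagonal Y hY
  simp only [conj_diagonal_mul hU, conj_diagonal_mul hV, conj_diagonal_pow hU hU',
    conj_diagonal_pow hV hV'] at h ⊢
  -- Conjugating turns the equality into `f i * W i j = W i j * g j` for `W = Uᵀ * V`; wherever `W i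
  -- j ≠ 0`, nonnegative `m`-th roots can be taken entry by entry.
  have transfer : ∀ f g : ι → ℝ, U * diagonal f * Uᵀ = V * diagonal g * Vᵀ ↔
      diagonal f * (Uᵀ * V) = (Uᵀ * V) * diagonal g := by
    intro f g
    constructor
    · intro H
      calc diagonal f * (Uᵀ * V) = Uᵀ * U * diagonal f * Uᵀ * V := by
            rw [hU, Matrix.one_mul, Matrix.mul_assoc]
        _ = Uᵀ * (U * diagonal f * Uᵀ) * V := by simp only [Matrix.mul_assoc]
        _ = Uᵀ * V * diagonal g * (Vᵀ * V) := by rw [H]; simp only [Matrix.mul_assoc]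
        _ = _ := by rw [hV, Matrix.mul_one]
    · intro H
      calc U * diagonal f * Uᵀ = U * diagonal f * Uᵀ * (V * Vᵀ) := by rw [hV', Matrix.mul_one]
        _ = U * (diagonal f * (Uᵀ * V)) * Vᵀ := by simp only [Matrix.mul_assoc]
        _ = (U * Uᵀ) * V * diagonal g * Vᵀ := by rw [H]; simp only [Matrix.mul_assoc]
        _ = _ := by rw [hU', Matrix.one_mul]
  rw [transfer] at h ⊢
  ext i j
  have hij := congrFun (congrFun h i) j
  simp only [diagonal_mul, mul_diagonal] at hij ⊢
  rcases eq_or_ne ((Uᵀ * V) i j) 0 with h0 | h0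
  · simp [h0]
  · rw [mul_comm] at hij
    have h1 := mul_left_cancel₀ h0 hij
    rw [(pow_left_inj₀ (mul_self_nonneg _) (mul_self_nonneg _) hm).1 h1, mul_comm]

/-- The one-parameter group of symmetric matrices with eigenvectors the columns of `U` and
eigenvalues `exp (s * c i)`. -/
noncomputable def expConj (U : Matrix ι ι ℝ) (c : ι → ℝ) (s : ℝ) : Matrix ι ι ℝ :=
  U * diagonal (fun i => Real.exp (s * c i)) * Uᵀ

theorem expConj_isSymm (U : Matrix ι ι ℝ) (c : ι → ℝ) (s : ℝ) : (expConj U c s).IsSymm := by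
  simp [expConj, Matrix.IsSymm, transpose_mul, Matrix.mul_assoc]

theorem expConj_mul {U : Matrix ι ι ℝ} (hU : Uᵀ * U = 1) (c : ι → ℝ) (s t : ℝ) :
    expConj U c s * expConj U c t = expConj U c (s + t) := by
  simp only [expConj, conj_diagonal_mul hU, ← Real.exp_add, add_mul]

theorem expConj_zero {U : Matrix ι ι ℝ} (hU' : U * Uᵀ = 1) (c : ι → ℝ) :
    expConj U c 0 = 1 := by
  simp [expConj, hU']

theorem expConj_pow {U : Matrix ι ι ℝ} (hU : Uᵀ * U = 1) (hU' : U * Uᵀ = 1) (c : ι → ℝ) (s : ℝ)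
    (m : ℕ) : expConj U c s ^ m = expConj U c (m * s) := by
  simp only [expConj, conj_diagonal_pow hU hU', ← Real.exp_nat_mul]
  simp only [mul_assoc]

theorem det_expConj {U : Matrix ι ι ℝ} (hU : Uᵀ * U = 1) (c : ι → ℝ) (s : ℝ) :
    (expConj U c s).det = Real.exp (s * ∑ i, c i) := by
  have h : Uᵀ.det * U.det = 1 := by rw [← det_mul, hU, det_one]
  rw [expConj, det_mul, det_mul, det_diagonal, ← Real.exp_sum, ← Finset.mul_sum]
  linear_combination Real.exp (s * ∑ i, c i) * h

theorem trace_expConj {U : Matrix ι ι ℝ} (hU : Uᵀ * U = 1) (c : ι → ℝ) (s : ℝ) :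
    (expConj U c s).trace = ∑ i, Real.exp (s * c i) := by
  rw [expConj, trace_mul_comm, ← Matrix.mul_assoc, hU, Matrix.one_mul, trace_diagonal]

/-- The square of a nonsingular real symmetric matrix lies in a one-parameter group. -/
theorem exists_mul_self_eq_expConj (A : Matrix ι ι ℝ) (hA : A.IsSymm) (hdet : A.det ≠ 0) :
    ∃ (U : Matrix ι ι ℝ) (c : ι → ℝ), Uᵀ * U = 1 ∧ U * Uᵀ = 1 ∧ A * A = expConj U c 1 := by
  obtain ⟨U, d, hU, hU', rfl⟩ := exists_orthogonal_diagonal A hA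
  have hd : ∀ i, d i ≠ 0 := by
    rw [det_mul, det_mul, det_diagonal] at hdet
    intro i
    exact Finset.prod_ne_zero_iff.1 (right_ne_zero_of_mul (left_ne_zero_of_mul hdet)) i
      (Finset.mem_univ i)
  refine ⟨U, fun i => Real.log (d i * d i), hU, hU', ?_⟩
  rw [conj_diagonal_mul hU, expConj]
  congr 3
  funext i
  rw [one_mul, Real.exp_log (mul_self_pos.2 (hd i))]

theorem mul_self_eq_expConj_of_pow_eq {U : Matrix ι ι ℝ} (hU : Uᵀ * U = 1) (hU' : U * Uᵀ = 1)
    {c : ι → ℝ} {B : Matrix ι ι ℝ} (hB : B.IsSymm) {m : ℕ} (hm : m ≠ 0) {s : ℝ}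
    (h : (B * B) ^ m = expConj U c s) : B * B = expConj U c (s / m) := by
  have hm' : (m : ℝ) ≠ 0 := Nat.cast_ne_zero.2 hm
  -- The target is itself the square of a symmetric matrix, as uniqueness of roots requires.
  have key : expConj U c (s / m / 2) * expConj U c (s / m / 2) = expConj U c (s / m) := by
    rw [expConj_mul hU, add_halves]
  rw [← key]
  refine mul_self_eq_of_pow_eq hB (expConj_isSymm _ _ _) hm ?_
  rw [key, expConj_pow hU hU', h, mul_div_cancel₀ _ hm']

theorem mul_self_eq_expConj_of_pow_eq_pow {U : Matrix ι ι ℝ} (hU : Uᵀ * U = 1) (hU' : U * Uᵀ = 1)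
    {c : ι → ℝ} {A B : Matrix ι ι ℝ} (hB : B.IsSymm) (hA : A * A = expConj U c 1) {m a : ℕ}
    (hm : m ≠ 0) (h : B ^ m = A ^ a) : B * B = expConj U c ((a : ℝ) / m) := by
  refine mul_self_eq_expConj_of_pow_eq hU hU' hB hm ?_
  rw [(Commute.refl B).mul_pow, h, ← (Commute.refl A).mul_pow, hA, expConj_pow hU hU', mul_one]

theorem mul_self_eq_expConj_of_pow_mul_pow {U : Matrix ι ι ℝ} (hU : Uᵀ * U = 1)
    (hU' : U * Uᵀ = 1) {c : ι → ℝ} {A B : Matrix ι ι ℝ} (hB : B.IsSymm)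
    (hA : A * A = expConj U c 1) {m a : ℕ}
    (hm : m ≠ 0) (h : B ^ m * A ^ a = 1) : B * B = expConj U c (-(a : ℝ) / m) := by
  refine mul_self_eq_expConj_of_pow_eq hU hU' hB hm ?_
  have h' : A ^ a * B ^ m = 1 := mul_eq_one_comm.1 h
  have h1 : (B * B) ^ m * expConj U c a = 1 := by
    have h2 : expConj U c a = A ^ a * A ^ a := by
      rw [← (Commute.refl A).mul_pow, hA, expConj_pow hU hU', mul_one]
    rw [(Commute.refl B).mul_pow, h2, Matrix.mul_assoc, ← Matrix.mul_assoc (B ^ m) (A ^ a), h,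
      Matrix.one_mul, h]
  calc (B * B) ^ m = (B * B) ^ m * (expConj U c a * expConj U c (-a)) := by
        rw [expConj_mul hU, add_neg_cancel, expConj_zero hU', Matrix.mul_one]
    _ = _ := by rw [← Matrix.mul_assoc, h1, Matrix.one_mul]

/-- Near the parameter `0` the entries of `expConj U c s` are close to those of the identity. -/
theorem abs_expConj_sub_one_lt_one {U : Matrix ι ι ℝ} (hU' : U * Uᵀ = 1) {c : ι → ℝ} {s : ℝ}
    (hs : ∀ i, |s * c i| < 1 / 2) (i j : ι) : |(expConj U c s - 1) i j| < 1 := by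
  have hrow : ∀ i, ∑ k, U i k ^ 2 = 1 := by
    intro i
    have h := congrFun (congrFun hU' i) i
    rw [Matrix.mul_apply] at h
    simpa [sq] using h
  have hentry : (expConj U c s - 1) i j = ∑ k, (Real.exp (s * c k) - 1) * (U i k * U j k) := by
    have h := congrFun (congrFun hU' i) j
    rw [Matrix.mul_apply] at h
    rw [Matrix.sub_apply, ← h, expConj, Matrix.mul_apply, ← Finset.sum_sub_distrib]
    refine Finset.sum_congr rfl fun k _ => ?_
    rw [mul_diagonal, transpose_apply]
    ring
  have hexp : ∀ k, |Real.exp (s * c k) - 1| < 1 := fun k =>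
    lt_of_le_of_lt (Real.abs_exp_sub_one_le (by linarith [hs k])) (by linarith [hs k])
  have hex : ∃ k, U i k ≠ 0 := by
    by_contra! h
    have := hrow i
    simp [h] at this
  obtain ⟨k₀, hk₀⟩ := hex
  rw [hentry]
  calc |∑ k, (Real.exp (s * c k) - 1) * (U i k * U j k)|
      ≤ ∑ k, |(Real.exp (s * c k) - 1) * (U i k * U j k)| := Finset.abs_sum_le_sum_abs _ _
    -- The rows of `U` are unit vectors, so these AM-GM weights sum to 1 and the bound does not
    -- depend on the dimension.
    _ ≤ ∑ k, |Real.exp (s * c k) - 1| * ((U i k ^ 2 + U j k ^ 2) / 2) := by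
        refine Finset.sum_le_sum fun k _ => ?_
        rw [abs_mul]
        refine mul_le_mul_of_nonneg_left ?_ (abs_nonneg _)
        rw [abs_le]
        constructor <;> nlinarith [sq_nonneg (U i k + U j k), sq_nonneg (U i k - U j k)]
    _ < ∑ k, 1 * ((U i k ^ 2 + U j k ^ 2) / 2) := by
        refine Finset.sum_lt_sum (fun k _ => ?_) ⟨k₀, Finset.mem_univ _, ?_⟩
        · exact mul_le_mul_of_nonneg_right (hexp k).le (by positivity)
        · exact mul_lt_mul_of_pos_right (hexp k₀) (by positivity)
    _ = 1 := by
        simp only [one_mul]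
        rw [← Finset.sum_div, Finset.sum_add_distrib, hrow, hrow]
        norm_num

end SpectralPowers

/-! ### Integer matrices: a logarithmically bounded index that determines `B * B`. -/

section IntegerMatrices

variable {ι : Type*} [Fintype ι] [DecidableEq ι]

theorem mapMatrix_intCast_injective {R : Type*} [CommRing R] [CharZero R] :
    Function.Injective ((Int.castRingHom R).mapMatrix : Matrix ι ι ℤ →+* Matrix ι ι R) := by
  intro X Y h
  exact Matrix.map_injective (f := (Int.cast : ℤ → R)) Int.cast_injective h

/-- A positive power of `B` is a power of `A` or of its inverse. -/
def PowRelated (A B : Matrix ι ι ℤ) : Prop :=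
  ∃ m a : ℕ, m ≠ 0 ∧ (B ^ m = A ^ a ∨ B ^ m * A ^ a = 1)

/-- If the exponent of `B` vanished, a positive power of `A` would be the identity; otherwise signs
are moved across to leave natural exponents. -/
theorem MultDependent.powRelated {n : ℕ} {A B : Matrix (Fin n) (Fin n) ℤ}
    (h : MultDependent A B) (hA : A.det ≠ 0) (hB : B.det ≠ 0) (hroot : ¬ IsRootOfIdentity A) :
    PowRelated A B := by
  obtain ⟨k, l, hkl, h⟩ := h
  let φ := (Int.castRingHom ℚ).mapMatrix (m := Fin n)
  change φ A ^ k * φ B ^ l = 1 at h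
  have hinj : Function.Injective φ := mapMatrix_intCast_injective
  have hunit : ∀ (X : Matrix (Fin n) (Fin n) ℤ) (m : ℕ), X.det ≠ 0 → IsUnit (φ X ^ m).det := by
    intro X m hX
    rw [det_pow]
    refine IsUnit.pow _ (isUnit_iff_ne_zero.2 ?_)
    rw [← RingHom.map_det]
    simpa using hX
  have hpow : B ^ l.natAbs = A ^ k.natAbs ∨ B ^ l.natAbs * A ^ k.natAbs = 1 := by
    rw [← hinj.eq_iff, ← hinj.eq_iff (a := B ^ _ * A ^ _)]
    simp only [map_mul, map_pow, map_one]
    have uA := hunit A k.natAbs hA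
    have uB := hunit B l.natAbs hB
    obtain ⟨a, rfl | rfl⟩ := k.eq_nat_or_neg <;> obtain ⟨m, rfl | rfl⟩ := l.eq_nat_or_neg <;>
      simp only [Int.natAbs_neg, Int.natAbs_natCast, zpow_natCast,
        Matrix.zpow_neg_natCast] at h uA uB ⊢
    · exact Or.inr (mul_eq_one_comm.1 h)
    · left
      have := congrArg (· * φ B ^ m) h
      simpa [Matrix.mul_assoc, Matrix.nonsing_inv_mul _ uB] using this.symm
    · left
      have := congrArg (φ A ^ a * ·) h
      simpa [← Matrix.mul_assoc, Matrix.mul_nonsing_inv _ uA] using this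
    · right
      rw [← Matrix.mul_inv_rev] at h
      have := congrArg (φ B ^ m * φ A ^ a * ·) h
      rw [Matrix.mul_nonsing_inv _ (by rw [det_mul]; exact uB.mul uA), Matrix.mul_one] at this
      exact this.symm
  refine ⟨l.natAbs, k.natAbs, fun hl => ?_, hpow⟩
  refine hroot ⟨k.natAbs, ?_, ?_⟩
  · rw [Int.natAbs_eq_zero] at hl
    exact Int.natAbs_pos.2 (hkl.resolve_right (not_not_intro hl))
  · simpa [hl, eq_comm] using hpow

theorem trace_mul_self_le {ι : Type*} [Fintype ι] {B : Matrix ι ι ℝ} {N : ℝ} (hN : ∀ i j, |B i j| ≤ N) :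
    (B * B).trace ≤ ((Fintype.card ι : ℝ) * N) ^ 2 := by
  calc (B * B).trace = ∑ i, ∑ j, B i j * B j i := by simp [Matrix.trace, Matrix.mul_apply]
    _ ≤ ∑ _i : ι, ∑ _j : ι, N * N := by
        refine Finset.sum_le_sum fun i _ => Finset.sum_le_sum fun j _ => ?_
        calc B i j * B j i ≤ |B i j * B j i| := le_abs_self _
          _ = |B i j| * |B j i| := abs_mul _ _
          _ ≤ N * N := mul_le_mul (hN i j) (hN j i) (abs_nonneg _)
              ((abs_nonneg _).trans (hN i j))
    _ = _ := by simp; ring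

theorem abs_det_le_card_mul_pow {B : Matrix ι ι ℝ} {N : ℝ} (h0 : 0 ≤ N) (hN : ∀ i j, |B i j| ≤ N) :
    |B.det| ≤ ((Fintype.card ι : ℝ) * N) ^ Fintype.card ι := by
  have h := Matrix.det_le (abv := AbsoluteValue.abs) (x := N) (A := B) hN
  rw [AbsoluteValue.abs_apply, nsmul_eq_mul] at h
  refine h.trans ?_
  rw [mul_pow]
  refine mul_le_mul_of_nonneg_right ?_ (pow_nonneg h0 _)
  exact_mod_cast Nat.factorial_le_pow _

/-- The symmetric nonsingular integer matrices with entries at most `N` a positive power of which is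
a power of `A` or of its inverse. -/
def relatedMatrices (A : Matrix ι ι ℤ) (N : ℝ) : Set (Matrix ι ι ℤ) :=
  {B | B.IsSymm ∧ (∀ i j, |(B i j : ℝ)| ≤ N) ∧ B.det ≠ 0 ∧ PowRelated A B}

/-- If `A` is not unimodular, then the `p`-adic valuation of `det B` determines `B * B`. -/
theorem exists_index_of_not_isUnit_det [Nonempty ι] {A : Matrix ι ι ℤ} (hA : A.IsSymm)
    (hdet : A.det ≠ 0) (hunit : ¬ IsUnit A.det) {N : ℝ} (hN : 1 ≤ N) :
    ∃ g : Matrix ι ι ℤ → ℤ,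
      (∀ B ∈ relatedMatrices A N,
        |(g B : ℝ)| ≤ 4 * Fintype.card ι * Real.log (Fintype.card ι * N) + 1) ∧
      ∀ B ∈ relatedMatrices A N, ∀ B' ∈ relatedMatrices A N, g B = g B' → B * B = B' * B' := by
  have hcard : (1 : ℝ) ≤ Fintype.card ι := by exact_mod_cast Fintype.card_pos
  have hcN : 1 ≤ Fintype.card ι * N := one_le_mul_of_one_le_of_one_le hcard hN
  let ψ := (Int.castRingHom ℝ).mapMatrix (m := ι)
  have hsymm : ∀ {X : Matrix ι ι ℤ}, X.IsSymm → (ψ X).IsSymm := fun hX => hX.map _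
  have hψdet : (ψ A).det ≠ 0 := by
    rw [← RingHom.map_det]
    simpa using hdet
  obtain ⟨U, c, hU, hU', hAA⟩ := exists_mul_self_eq_expConj (ψ A) (hsymm hA) hψdet
  set p := A.det.natAbs.minFac with hp
  have hne : A.det.natAbs ≠ 1 := fun h => hunit (Int.isUnit_iff_natAbs_eq.2 h)
  have : Fact p.Prime := ⟨Nat.minFac_prime hne⟩
  let v : Matrix ι ι ℤ → ℕ := fun X => padicValNat p X.det.natAbs
  have hvA : v A ≠ 0 := by
    have : 1 ≤ v A := one_le_padicValNat_of_dvd (Int.natAbs_ne_zero.2 hdet) (Nat.minFac_dvd _)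
    omega
  -- Determinants in `B ^ m = A ^ a` give `m * v B = a * v A`, so the parameter `a / m` depends only
  -- on `v B`.
  have hparam : ∀ B ∈ relatedMatrices A N,
      ψ B * ψ B = expConj U c ((v B : ℝ) / v A) := by
    rintro B ⟨hB, -, hBdet, m, a, hm, h | h⟩
    · have h1 : ψ B ^ m = ψ A ^ a := by rw [← map_pow, h, map_pow]
      rw [mul_self_eq_expConj_of_pow_eq_pow hU hU' (hsymm hB) hAA hm h1]
      congr 1
      have h2 : m * v B = a * v A := by
        have h3 := congrArg (fun X : Matrix ι ι ℤ => padicValNat p X.det.natAbs) h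
        simp only [det_pow, Int.natAbs_pow] at h3
        rwa [padicValNat.pow, padicValNat.pow] at h3
      rw [div_eq_div_iff (Nat.cast_ne_zero.2 hm) (Nat.cast_ne_zero.2 hvA)]
      exact_mod_cast (h2.symm.trans (mul_comm _ _))
    · have h1 := congrArg Matrix.det h
      rw [det_mul, det_pow, det_pow, det_one] at h1
      have h2 : IsUnit (A.det ^ a) := IsUnit.of_mul_eq_one_right _ h1
      -- The inverse case forces `a = 0`, since `A.det ^ a` is a unit and `A.det` is not.
      rcases eq_or_ne a 0 with rfl | ha
      · have h3 : ψ B ^ m = ψ A ^ 0 := by rw [← map_pow, ← map_pow]; congr 1; simpa using h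
        rw [mul_self_eq_expConj_of_pow_eq_pow hU hU' (hsymm hB) hAA hm h3]
        congr 1
        have h4 : IsUnit B.det := by
          rw [← isUnit_pow_iff hm]
          exact IsUnit.of_mul_eq_one _ h1
        have h5 : v B = 0 := by simp [v, Int.isUnit_iff_natAbs_eq.1 h4]
        simp [h5]
      · exact absurd ((isUnit_pow_iff ha).1 h2) hunit
  refine ⟨fun B => v B, ?_, ?_⟩
  · rintro B ⟨hB, hBN, hBdet, -⟩
    have h1 : (2 : ℝ) ^ v B ≤ (Fintype.card ι * N) ^ Fintype.card ι := by
      have h2 : 2 ^ v B ≤ B.det.natAbs := by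
        calc 2 ^ v B ≤ p ^ v B := Nat.pow_le_pow_left (Nat.Prime.two_le Fact.out) _
          _ ≤ _ := Nat.le_of_dvd (Int.natAbs_pos.2 hBdet) pow_padicValNat_dvd
      calc (2 : ℝ) ^ v B ≤ (B.det.natAbs : ℝ) := by exact_mod_cast h2
        _ = |(ψ B).det| := by
            rw [← RingHom.map_det, Nat.cast_natAbs]
            simp
        _ ≤ _ := abs_det_le_card_mul_pow (by linarith) hBN
    -- Since `log 2 > 1/2`, this gives `v B ≤ 2 n log (n N)`; the weaker claimed bound is shared
    -- with the unimodular case.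
    have h3 := Real.log_le_log (by positivity) h1
    rw [Real.log_pow, Real.log_pow] at h3
    have h4 := Real.log_two_gt_d9
    have h5 : (0 : ℝ) ≤ v B := Nat.cast_nonneg _
    have h6 : 0 ≤ Fintype.card ι * Real.log (Fintype.card ι * N) :=
      mul_nonneg (by linarith) (Real.log_nonneg hcN)
    simp only [Int.cast_natCast, abs_of_nonneg h5]
    nlinarith
  · intro B hB B' hB' h
    have h' : v B = v B' := Int.ofNat_inj.1 h
    apply mapMatrix_intCast_injective (R := ℝ)
    change ψ _ = ψ _
    rw [map_mul, map_mul, hparam B hB, hparam B' hB', h']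

/-- If `A` is unimodular, then the parameters of the squares `B * B` in the one-parameter group of
`A * A` are uniformly discrete. -/
theorem exists_index_of_isUnit_det [Nonempty ι] {A : Matrix ι ι ℤ} (hA : A.IsSymm)
    (hunit : IsUnit A.det) {N : ℝ} (hN : 1 ≤ N) :
    ∃ g : Matrix ι ι ℤ → ℤ,
      (∀ B ∈ relatedMatrices A N,
        |(g B : ℝ)| ≤ 4 * Fintype.card ι * Real.log (Fintype.card ι * N) + 1) ∧
      ∀ B ∈ relatedMatrices A N, ∀ B' ∈ relatedMatrices A N, g B = g B' → B * B = B' * B' := by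
  have hcard : (1 : ℝ) ≤ Fintype.card ι := by exact_mod_cast Fintype.card_pos
  have hcN : 1 ≤ Fintype.card ι * N := one_le_mul_of_one_le_of_one_le hcard hN
  let ψ := (Int.castRingHom ℝ).mapMatrix (m := ι)
  have hsymm : ∀ {X : Matrix ι ι ℤ}, X.IsSymm → (ψ X).IsSymm := fun hX => hX.map _
  have hψdet : (ψ A).det ≠ 0 := by
    rw [← RingHom.map_det]
    simpa using hunit.ne_zero
  obtain ⟨U, c, hU, hU', hAA⟩ := exists_mul_self_eq_expConj (ψ A) (hsymm hA) hψdet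
  have hsum : ∑ i, c i = 0 := by
    have h1 := det_expConj hU c 1
    have h2 : (A * A).det = 1 := by rw [det_mul]; exact Int.isUnit_mul_self hunit
    rw [← hAA, ← map_mul, ← RingHom.map_det, h2, map_one, one_mul, eq_comm, Real.exp_eq_one_iff]
      at h1
    exact h1
  have hparam : ∀ B, ∃ r : ℝ, B ∈ relatedMatrices A N → ψ B * ψ B = expConj U c r := by
    intro B
    by_cases hB : B ∈ relatedMatrices A N
    · obtain ⟨hB, -, hBdet, m, a, hm, h | h⟩ := hB
      · have h1 : ψ B ^ m = ψ A ^ a := by rw [← map_pow, h, map_pow]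
        exact ⟨_, fun _ => mul_self_eq_expConj_of_pow_eq_pow hU hU' (hsymm hB) hAA hm h1⟩
      · have h1 : ψ B ^ m * ψ A ^ a = 1 := by rw [← map_pow, ← map_pow, ← map_mul, h, map_one]
        exact ⟨_, fun _ => mul_self_eq_expConj_of_pow_mul_pow hU hU' (hsymm hB) hAA hm h1⟩
    · exact ⟨0, fun h => absurd h hB⟩
  choose r hr using hparam
  obtain ⟨i₀, -, hi₀⟩ := Finset.exists_max_image Finset.univ (fun i => |c i|)
    Finset.univ_nonempty
  -- The factor 2 and the maximality of `|c i₀|` make equal floors imply `|(r B - r B') * c i| < 1 /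
  -- 2` for every `i`.
  refine ⟨fun B => ⌊2 * (r B * |c i₀|)⌋, ?_, ?_⟩
  · intro B hB
    have hle : ∀ j, r B * c j ≤ 2 * Real.log (Fintype.card ι * N) := by
      intro j
      have h1 : Real.exp (r B * c j) ≤ (Fintype.card ι * N) ^ 2 := by
        calc Real.exp (r B * c j) ≤ ∑ i, Real.exp (r B * c i) :=
              Finset.single_le_sum (f := fun i => Real.exp (r B * c i))
                (fun i _ => (Real.exp_pos _).le) (Finset.mem_univ j)
          _ = (ψ B * ψ B).trace := by rw [hr B hB, trace_expConj hU]
          _ ≤ _ := trace_mul_self_le hB.2.1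
      have h2 := (Real.le_log_iff_exp_le (by positivity)).2 h1
      rwa [Real.log_pow, Nat.cast_ofNat] at h2
    have hlog : 0 ≤ Real.log (Fintype.card ι * N) := Real.log_nonneg hcN
    -- The trace bounds each exponent from above; as the exponents sum to zero, this also bounds
    -- them from below.
    have habs : |r B * c i₀| ≤ 2 * Fintype.card ι * Real.log (Fintype.card ι * N) := by
      rw [abs_le]
      constructor
      · have h1 : ∑ j, r B * c j = 0 := by rw [← Finset.mul_sum, hsum, mul_zero]
        rw [← Finset.add_sum_erase _ _ (Finset.mem_univ i₀)] at h1
        have h2 : ∑ j ∈ Finset.univ.erase i₀, r B * c j ≤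
            ∑ j ∈ Finset.univ.erase i₀, 2 * Real.log (Fintype.card ι * N) :=
          Finset.sum_le_sum fun j _ => hle j
        have h3 : ∑ j ∈ Finset.univ.erase i₀, 2 * Real.log (Fintype.card ι * N) ≤
            ∑ _j : ι, 2 * Real.log (Fintype.card ι * N) :=
          Finset.sum_le_sum_of_subset_of_nonneg (Finset.erase_subset _ _)
            (fun _ _ _ => by positivity)
        rw [Finset.sum_const (s := Finset.univ), nsmul_eq_mul, Finset.card_univ] at h3
        linarith
      · refine (hle i₀).trans ?_
        nlinarith
    have hx : |2 * (r B * |c i₀|)| ≤ 4 * Fintype.card ι * Real.log (Fintype.card ι * N) := by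
      rw [abs_mul, abs_mul, abs_abs, ← abs_mul, abs_two]
      linarith
    have h1 := Int.floor_le (2 * (r B * |c i₀|))
    have h2 := Int.lt_floor_add_one (2 * (r B * |c i₀|))
    rw [abs_le] at hx ⊢
    constructor <;> linarith [hx.1, hx.2]
  · intro B hB B' hB' h
    have h1 := Int.abs_sub_lt_one_of_floor_eq_floor h
    have h2 : ∀ i, |(r B - r B') * c i| < 1 / 2 := by
      intro i
      rw [abs_mul]
      have h3 : |2 * (r B * |c i₀|) - 2 * (r B' * |c i₀|)| = 2 * (|r B - r B'| * |c i₀|) := by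
        rw [← mul_sub, ← sub_mul, abs_mul, abs_mul, abs_abs, abs_two]
      have h4 := mul_le_mul_of_nonneg_left (hi₀ i (Finset.mem_univ i)) (abs_nonneg (r B - r B'))
      linarith
    have hB'unit : IsUnit (B' * B').det := by
      have h5 := det_expConj hU c (r B')
      rw [hsum, mul_zero, Real.exp_zero, ← hr B' hB', ← map_mul, ← RingHom.map_det] at h5
      have h6 : (B' * B').det = 1 := Int.cast_injective (α := ℝ) (by simpa using h5)
      rw [h6]
      exact isUnit_one
    -- Unimodularity keeps the inverse integral, so `B * B * C` is an integer matrix at parameter `r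
    -- B - r B'`.
    set C := (B' * B')⁻¹ with hC
    have hCB : C * (B' * B') = 1 := nonsing_inv_mul _ hB'unit
    have hψC : ψ C = expConj U c (-r B') := by
      calc ψ C = ψ C * (expConj U c (r B') * expConj U c (-r B')) := by
            rw [expConj_mul hU, add_neg_cancel, expConj_zero hU', Matrix.mul_one]
        _ = ψ (C * (B' * B')) * expConj U c (-r B') := by
            rw [map_mul, map_mul, hr B' hB', Matrix.mul_assoc]
        _ = _ := by rw [hCB, map_one, Matrix.one_mul]
    have hD : ψ (B * B * C) = expConj U c (r B - r B') := by
      rw [map_mul, map_mul, hr B hB, hψC, expConj_mul hU, sub_eq_add_neg]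
    have hone : B * B * C = 1 := by
      rw [← sub_eq_zero]
      ext i j
      have h7 := abs_expConj_sub_one_lt_one hU' h2 i j
      rw [← hD, ← map_one ψ, ← map_sub] at h7
      have h8 : |((B * B * C - 1) i j : ℝ)| < 1 := h7
      rw [Matrix.zero_apply]
      exact Int.abs_lt_one_iff.1 (by exact_mod_cast h8)
    calc B * B = B * B * (C * (B' * B')) := by rw [hCB, Matrix.mul_one]
      _ = B' * B' := by rw [← Matrix.mul_assoc, hone, Matrix.one_mul]

end IntegerMatrices

/-! ### Counting pairs for the upper bound. -/

section Counting

/-- The entry of a symmetric matrix at an unordered pair of indices. -/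
noncomputable def symEntry {ι R : Type*} (A : Matrix ι ι R) (z : Sym2 ι) : R :=
  A (Quot.out z).1 (Quot.out z).2

theorem symEntry_mk {ι R : Type*} {A : Matrix ι ι R} (hA : A.IsSymm) (i j : ι) :
    symEntry A s(i, j) = A i j := by
  have h : s((Quot.out s(i, j)).1, (Quot.out s(i, j)).2) = s(i, j) := Quot.out_eq s(i, j)
  rcases Sym2.eq_iff.1 h with ⟨h1, h2⟩ | ⟨h1, h2⟩
  · rw [symEntry, h1, h2]
  · rw [symEntry, h1, h2, hA.apply]

/-- The integers of absolute value at most `x`. -/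
noncomputable def intBall (x : ℝ) : Finset ℤ := Finset.Icc (-⌊x⌋) ⌊x⌋

theorem mem_intBall {x : ℝ} {a : ℤ} : a ∈ intBall x ↔ |(a : ℝ)| ≤ x := by
  rw [intBall, Finset.mem_Icc, ← abs_le, Int.le_floor, Int.cast_abs]

theorem card_intBall_le {x : ℝ} (hx : 0 ≤ x) : ((intBall x).card : ℝ) ≤ 2 * x + 1 := by
  have h0 : 0 ≤ ⌊x⌋ := Int.floor_nonneg.2 hx
  have h : (((intBall x).card : ℤ) : ℝ) = ((⌊x⌋ + 1 - -⌊x⌋ : ℤ) : ℝ) := by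
    rw [intBall, Int.card_Icc, Int.toNat_of_nonneg (by omega)]
  push_cast at h
  linarith [Int.floor_le x]

variable {ι : Type*} [Fintype ι] [DecidableEq ι]

theorem ncard_symm_le (N : ℝ) (S : Set (Matrix ι ι ℤ))
    (hS : ∀ A ∈ S, A.IsSymm ∧ ∀ i j, |(A i j : ℝ)| ≤ N) :
    S.Finite ∧ S.ncard ≤ (intBall N).card ^ (Fintype.card ι + 1).choose 2 := by
  let F : Finset (Sym2 ι → ℤ) := Fintype.piFinset fun _ => intBall N
  have hmaps : ∀ A ∈ S, symEntry A ∈ (F : Set (Sym2 ι → ℤ)) := fun A hA =>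
    Fintype.mem_piFinset.2 fun z => mem_intBall.2 ((hS A hA).2 _ _)
  have hinj : Set.InjOn symEntry S := by
    intro A hA B hB h
    ext i j
    rw [← symEntry_mk (hS A hA).1, h, symEntry_mk (hS B hB).1]
  refine ⟨Set.Finite.of_injOn hmaps hinj F.finite_toSet, ?_⟩
  have h := Set.ncard_le_ncard_of_injOn _ hmaps hinj F.finite_toSet
  rwa [Set.ncard_coe_finset, Fintype.card_piFinset, Finset.prod_const, Finset.card_univ,
    Sym2.card] at h

/-- A symmetric integer matrix is determined by its square, its off-diagonal entries and the signs
of its diagonal entries. -/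
theorem eq_of_mul_self_eq_of_offDiag_eq {B B' : Matrix ι ι ℤ} (hB : B.IsSymm) (hB' : B'.IsSymm)
    (hsq : B * B = B' * B') (hoff : ∀ i j, i ≠ j → B i j = B' i j)
    (hsign : ∀ i, 0 ≤ B i i ↔ 0 ≤ B' i i) : B = B' := by
  ext i j
  rcases eq_or_ne i j with rfl | hij
  · have hii : ∀ {X : Matrix ι ι ℤ}, X.IsSymm →
        (X * X) i i = X i i ^ 2 + ∑ k ∈ Finset.univ.erase i, X i k ^ 2 := by
      intro X hX
      rw [Matrix.mul_apply, ← Finset.add_sum_erase _ _ (Finset.mem_univ i), sq]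
      congr 1
      exact Finset.sum_congr rfl fun k _ => by rw [hX.apply, sq]
    have hsum : ∑ k ∈ Finset.univ.erase i, B i k ^ 2 = ∑ k ∈ Finset.univ.erase i, B' i k ^ 2 :=
      Finset.sum_congr rfl fun k hk => by rw [hoff i k (Finset.ne_of_mem_erase hk).symm]
    have h := congrFun (congrFun hsq i) i
    rw [hii hB, hii hB', hsum, add_left_inj] at h
    rcases sq_eq_sq_iff_eq_or_eq_neg.1 h with h | h
    · exact h
    · have := hsign i
      omega
  · exact hoff i j hij

/-- The three factors count the index of `B * B`, the off-diagonal entries and the diagonal signs.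
-/
theorem card_relatedMatrices_le [Nonempty ι] {A : Matrix ι ι ℤ} (hA : A.IsSymm) (hdet : A.det ≠ 0)
    {N : ℝ} (hN : 1 ≤ N) (S : Finset (Matrix ι ι ℤ)) (hS : ∀ B ∈ S, B ∈ relatedMatrices A N) :
    S.card ≤ (intBall (4 * Fintype.card ι * Real.log (Fintype.card ι * N) + 1)).card *
      ((intBall N).card ^ (Fintype.card ι).choose 2 * 2 ^ Fintype.card ι) := by
  obtain ⟨g, hg, hg'⟩ : ∃ g : Matrix ι ι ℤ → ℤ,
      (∀ B ∈ relatedMatrices A N,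
        |(g B : ℝ)| ≤ 4 * Fintype.card ι * Real.log (Fintype.card ι * N) + 1) ∧
      ∀ B ∈ relatedMatrices A N, ∀ B' ∈ relatedMatrices A N, g B = g B' → B * B = B' * B' := by
    by_cases hu : IsUnit A.det
    · exact exists_index_of_isUnit_det hA hu hN
    · exact exists_index_of_not_isUnit_det hA hdet hu hN
  let F : Finset (ℤ × ({z : Sym2 ι // ¬ z.IsDiag} → ℤ) × (ι → Bool)) :=
    intBall (4 * Fintype.card ι * Real.log (Fintype.card ι * N) + 1) ×ˢ
      ((Fintype.piFinset fun _ => intBall N) ×ˢ Finset.univ)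
  let f : Matrix ι ι ℤ → ℤ × ({z : Sym2 ι // ¬ z.IsDiag} → ℤ) × (ι → Bool) := fun B =>
    (g B, fun z => symEntry B z, fun i => decide (0 ≤ B i i))
  have hmaps : Set.MapsTo f S F := by
    intro B hB
    have hB' := hS B hB
    simp only [F, f, Finset.mem_coe, Finset.mem_product, Finset.mem_univ, and_true,
      Fintype.mem_piFinset, mem_intBall]
    exact ⟨hg B hB', fun z => hB'.2.1 _ _⟩
  have hinj : Set.InjOn f S := by
    intro B hB B' hB' h
    have rB := hS B hB
    have rB' := hS B' hB'
    simp only [f, Prod.mk.injEq] at h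
    obtain ⟨h1, h2, h3⟩ := h
    refine eq_of_mul_self_eq_of_offDiag_eq rB.1 rB'.1 (hg' B rB B' rB' h1) (fun i j hij => ?_)
      (fun i => ?_)
    · have h4 := congrFun h2 ⟨s(i, j), by simpa using hij⟩
      rwa [symEntry_mk rB.1, symEntry_mk rB'.1] at h4
    · exact decide_eq_decide.1 (congrFun h3 i)
  have h := Finset.card_le_card_of_injOn f hmaps hinj
  rwa [Finset.card_product, Finset.card_product, Fintype.card_piFinset,
    Finset.prod_const, Finset.card_univ, Sym2.card_subtype_not_diag, Finset.card_univ, Fintype.card_fun, Fintype.card_bool] at h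

theorem symmPairs_finite (n : ℕ) (N : ℝ) : (symmPairs n N).Finite := by
  let T : Set (Matrix (Fin n) (Fin n) ℤ) := {A | A.IsSymm ∧ ∀ i j, |(A i j : ℝ)| ≤ N}
  have hT : T.Finite := (ncard_symm_le N T fun A hA => hA).1
  refine (hT.prod hT).subset ?_
  rintro ⟨A, B⟩ ⟨⟨⟨-, hA, -⟩, ⟨-, hB, -⟩, -⟩, hAs, hBs⟩
  exact ⟨⟨hAs, ((matHeight_le_iff A N).1 hA).2⟩, ⟨hBs, ((matHeight_le_iff B N).1 hB).2⟩⟩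

theorem symmPairs_eq_empty {n : ℕ} {N : ℝ} (hN : N < 1) : symmPairs n N = ∅ := by
  rw [Set.eq_empty_iff_forall_notMem]
  rintro ⟨A, B⟩ ⟨⟨⟨-, hA, -⟩, -⟩, -⟩
  exact absurd ((matHeight_le_iff A N).1 hA).1 (not_le.2 hN)

theorem ncard_symmPairs_le {n : ℕ} (hn : 1 ≤ n) {N : ℝ} (hN : 1 ≤ N) :
    (symmPairs n N).ncard ≤ ((intBall (4 * n * Real.log (n * N) + 1)).card *
      ((intBall N).card ^ n.choose 2 * 2 ^ n)) * (intBall N).card ^ (n + 1).choose 2 := by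
  classical
  have : Nonempty (Fin n) := ⟨⟨0, hn⟩⟩
  have hfin := symmPairs_finite n N
  set S := hfin.toFinset with hSdef
  have hmem : ∀ {p}, p ∈ S → p ∈ symmPairs n N := fun hp => hfin.mem_toFinset.1 hp
  rw [Set.ncard_eq_toFinset_card _ hfin]
  have himage : (S.image Prod.fst).card ≤ (intBall N).card ^ (n + 1).choose 2 := by
    have h := (ncard_symm_le N ((S.image Prod.fst : Finset _) : Set (Matrix (Fin n) (Fin n) ℤ)) ?_).2
    · rwa [Set.ncard_coe_finset, Fintype.card_fin] at h
    · intro A hA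
      obtain ⟨p, hp, rfl⟩ := Finset.mem_image.1 (Finset.mem_coe.1 hA)
      obtain ⟨⟨⟨-, h, -⟩, -⟩, hs, -⟩ := hmem hp
      exact ⟨hs, ((matHeight_le_iff _ N).1 h).2⟩
  refine (Finset.card_le_mul_card_image (f := Prod.fst) S _ fun A hA => ?_).trans
    (Nat.mul_le_mul_left _ himage)
  obtain ⟨p, hp, rfl⟩ := Finset.mem_image.1 hA
  obtain ⟨⟨⟨-, -, hdet⟩, -⟩, hs, -⟩ := hmem hp
  have h := card_relatedMatrices_le hs hdet hN ((S.filter fun q => q.1 = p.1).image Prod.snd) ?_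
  · rw [Finset.card_image_of_injOn, Fintype.card_fin] at h
    · exact h
    · intro q hq q' hq' h
      exact Prod.ext ((Finset.mem_filter.1 hq).2.trans (Finset.mem_filter.1 hq').2.symm) h
  · intro B hB
    obtain ⟨⟨A', B'⟩, hq, rfl⟩ := Finset.mem_image.1 hB
    obtain ⟨hq, rfl⟩ := Finset.mem_filter.1 hq
    obtain ⟨⟨⟨-, -, hAdet⟩, ⟨-, hBN, hBdet⟩, hdep, hroot, -⟩, -, hBs⟩ := hmem hq
    exact ⟨hBs, ((matHeight_le_iff _ N).1 hBN).2, hBdet, hdep.powRelated hAdet hBdet hroot⟩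

theorem choose_two_add_succ_choose_two (n : ℕ) : n.choose 2 + (n + 1).choose 2 = n ^ 2 := by
  have h : ((n.choose 2 + (n + 1).choose 2 : ℕ) : ℚ) = ((n ^ 2 : ℕ) : ℚ) := by
    push_cast [Nat.cast_choose_two]
    ring
  exact_mod_cast h

theorem ncard_symmPairs_le_mul_log {n : ℕ} (hn : 1 ≤ n) {N : ℝ} (hN : 1 ≤ N) :
    ((symmPairs n N).ncard : ℝ) ≤
      (8 * n * Real.log (n * N) + 3) * 2 ^ n * (3 * N) ^ (n ^ 2) := by
  have hn' : (1 : ℝ) ≤ n := by exact_mod_cast hn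
  have hlog : 0 ≤ Real.log (n * N) := Real.log_nonneg (one_le_mul_of_one_le_of_one_le hn' hN)
  have h : ((symmPairs n N).ncard : ℝ) ≤ ((intBall (4 * n * Real.log (n * N) + 1)).card *
      ((intBall N).card ^ n.choose 2 * 2 ^ n)) * (intBall N).card ^ (n + 1).choose 2 := by
    exact_mod_cast ncard_symmPairs_le hn hN
  have h1 : ((intBall N).card : ℝ) ≤ 3 * N := (card_intBall_le (by linarith)).trans (by linarith)
  have h2 : ((intBall (4 * n * Real.log (n * N) + 1)).card : ℝ) ≤ 8 * n * Real.log (n * N) + 3 :=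
    (card_intBall_le (by positivity)).trans (by linarith)
  calc ((symmPairs n N).ncard : ℝ) ≤ _ := h
    _ = (intBall (4 * n * Real.log (n * N) + 1)).card * 2 ^ n * ((intBall N).card : ℝ) ^ (n ^ 2) := by
        rw [← choose_two_add_succ_choose_two, pow_add]
        ring
    _ ≤ _ := by gcongr

end Counting

/-! ### Explicit pairs for the lower bound. -/

section LowerBound

theorem isDiagonalizable_of_isSymm {n : ℕ} {A : Matrix (Fin n) (Fin n) ℤ} (hA : A.IsSymm) :
    IsDiagonalizable A := by
  have hH : (A.map (Int.cast : ℤ → ℂ)).IsHermitian := by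
    ext i j
    simp [conjTranspose_apply, hA.apply]
  have h1 := Unitary.coe_mul_star_self hH.eigenvectorUnitary
  have h2 := hH.spectral_theorem
  rw [Unitary.conjStarAlgAut_apply] at h2
  refine ⟨hH.eigenvectorUnitary, RCLike.ofReal ∘ hH.eigenvalues, ?_, h2.trans ?_⟩
  · have h3 := congrArg Matrix.det h1
    rw [det_mul, det_one] at h3
    exact IsUnit.of_mul_eq_one _ h3
  · rw [Matrix.inv_eq_right_inv h1]
    rfl

/-- Uniqueness of positive roots reduces `A ^ k = 1` to `A * A = 1`, but the `i`-th diagonal entry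
of `A * A` is at least 4. -/
theorem not_isRootOfIdentity_of_isSymm {n : ℕ} {A : Matrix (Fin n) (Fin n) ℤ} (hA : A.IsSymm)
    (i : Fin n) (hi : 2 ≤ A i i) : ¬ IsRootOfIdentity A := by
  rintro ⟨k, hk, h⟩
  let ψ := (Int.castRingHom ℝ).mapMatrix (m := Fin n)
  have h1 : (ψ A * ψ A) ^ k = (1 * 1) ^ k := by
    rw [(Commute.refl (ψ A)).mul_pow, ← map_pow, h, map_one, one_mul, one_pow]
  have h2 : ψ A * ψ A = 1 * 1 := mul_self_eq_of_pow_eq (hA.map _) Matrix.isSymm_one hk.ne' h1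
  have h3 : A * A = 1 := by
    apply mapMatrix_intCast_injective (R := ℝ)
    change ψ _ = ψ _
    rw [map_mul, map_one, h2, one_mul]
  have h4 := congrFun (congrFun h3 i) i
  rw [Matrix.mul_apply, one_apply_eq] at h4
  have h5 : A i i * A i i ≤ ∑ j, A i j * A j i :=
    Finset.single_le_sum (f := fun j => A i j * A j i)
      (fun j _ => by rw [hA.apply]; exact mul_self_nonneg _) (Finset.mem_univ i)
  nlinarith

/-- The symmetric matrix congruent to `2` modulo `3` with prescribed quotients. -/
def symmOfQuotients {n m : ℕ} (f : Sym2 (Fin n) → Fin m) : Matrix (Fin n) (Fin n) ℤ :=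
  fun i j => 3 * (f s(i, j) : ℕ) + if i = j then 2 else 0

theorem symmOfQuotients_isSymm {n m : ℕ} (f : Sym2 (Fin n) → Fin m) :
    (symmOfQuotients f).IsSymm := by
  ext i j
  simp [symmOfQuotients, Sym2.eq_swap (a := i), eq_comm (a := i)]

theorem symmOfQuotients_injective (n m : ℕ) :
    Function.Injective (symmOfQuotients : (Sym2 (Fin n) → Fin m) → _) := by
  intro f g h
  funext z
  induction z with
  | h i j =>
    have h1 := congrFun (congrFun h i) j
    simp only [symmOfQuotients] at h1
    exact Fin.ext (by omega)

/-- The determinant is congruent to `2 ^ n` modulo 3. -/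
theorem det_symmOfQuotients_ne_zero {n m : ℕ} (f : Sym2 (Fin n) → Fin m) :
    (symmOfQuotients f).det ≠ 0 := by
  intro h
  have h1 := (Int.castRingHom (ZMod 3)).map_det (symmOfQuotients f)
  have h2 : (Int.castRingHom (ZMod 3)).mapMatrix (symmOfQuotients f) =
      diagonal fun _ : Fin n => (2 : ZMod 3) := by
    ext i j
    have h3 : (3 : ZMod 3) = 0 := rfl
    by_cases hij : i = j <;> simp [symmOfQuotients, hij, h3]
  rw [h, h2, map_zero, det_diagonal, Finset.prod_const] at h1
  exact pow_ne_zero _ (by decide : (2 : ZMod 3) ≠ 0) h1.symm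

theorem symmOfQuotients_mem_symmPairs {n m : ℕ} (hn : 1 ≤ n) {N : ℝ} (hm : 1 ≤ m)
    (hmN : 3 * (m : ℝ) ≤ N + 1) (f : Sym2 (Fin n) → Fin m) :
    (symmOfQuotients f, symmOfQuotients f) ∈ symmPairs n N := by
  have hs := symmOfQuotients_isSymm f
  have hdet := det_symmOfQuotients_ne_zero f
  have hroot : ¬ IsRootOfIdentity (symmOfQuotients f) :=
    not_isRootOfIdentity_of_isSymm hs ⟨0, hn⟩ (by simp [symmOfQuotients])
  have hm' : (1 : ℝ) ≤ m := by exact_mod_cast hm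
  have hmem : symmOfQuotients f ∈ diagMatrices n N := by
    refine ⟨isDiagonalizable_of_isSymm hs, (matHeight_le_iff _ _).2 ⟨by linarith, fun i j => ?_⟩,
      hdet⟩
    have h1 : ((f s(i, j) : ℕ) : ℝ) + 1 ≤ m := by exact_mod_cast (f s(i, j)).2
    have h2 : (0 : ℝ) ≤ ((f s(i, j) : ℕ) : ℝ) := Nat.cast_nonneg _
    rw [abs_le]
    by_cases hij : i = j <;> simp only [symmOfQuotients, hij, if_true, if_false] <;>
      push_cast <;> constructor <;> (try rw [hij] at h1 h2) <;> linarith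
  refine ⟨⟨hmem, hmem, ⟨1, -1, Or.inl one_ne_zero, ?_⟩, hroot, hroot⟩, hs, hs⟩
  have hunit : IsUnit ((symmOfQuotients f).map (Int.cast : ℤ → ℚ)).det := by
    have h := (Int.castRingHom ℚ).map_det (symmOfQuotients f)
    rw [isUnit_iff_ne_zero]
    change ((Int.castRingHom ℚ).mapMatrix (symmOfQuotients f)).det ≠ 0
    rw [← h]
    simpa using hdet
  rw [zpow_one, Matrix.zpow_neg_one, Matrix.mul_nonsing_inv _ hunit]

theorem le_ncard_symmPairs {n : ℕ} (hn : 1 ≤ n) {N : ℝ} (hN : 2 ≤ N) :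
    (N / 6) ^ (n + 1).choose 2 ≤ ((symmPairs n N).ncard : ℝ) := by
  -- The largest entry is at most `3 * (m - 1) + 2`, hence the condition `3 * m ≤ N + 1`.
  set m := ⌊(N + 1) / 3⌋₊ with hmdef
  have h1 : (m : ℝ) ≤ (N + 1) / 3 := Nat.floor_le (by linarith)
  have h2 : (N + 1) / 3 < m + 1 := Nat.lt_floor_add_one _
  have hm : 1 ≤ m := Nat.le_floor (by push_cast; linarith)
  have hm' : (1 : ℝ) ≤ m := by exact_mod_cast hm
  have h3 : N / 6 ≤ m := by
    rcases le_total N 6 with h | h <;> linarith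
  have h4 : m ^ (n + 1).choose 2 ≤ (symmPairs n N).ncard := by
    have h := Set.ncard_le_ncard_of_injOn (s := Set.univ) (t := symmPairs n N)
      (fun f : Sym2 (Fin n) → Fin m => (symmOfQuotients f, symmOfQuotients f))
      (fun f _ => symmOfQuotients_mem_symmPairs hn hm (by linarith) f)
      (fun f _ g _ h => symmOfQuotients_injective n m (Prod.ext_iff.1 h).1) (symmPairs_finite n N)
    rwa [Set.ncard_univ, Nat.card_eq_fintype_card, Fintype.card_fun, Sym2.card, Fintype.card_fin,
      Fintype.card_fin] at h
  calc (N / 6) ^ (n + 1).choose 2 ≤ (m : ℝ) ^ (n + 1).choose 2 :=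
        pow_le_pow_left₀ (by linarith) h3 _
    _ ≤ _ := by exact_mod_cast h4

end LowerBound

/-! ### Assembly of the two bounds. -/

theorem theorem6 (n : ℕ) (hn : 1 ≤ n) (c : ℝ) (hc : 0 < c) :
    ∃ C₁ C₂ : ℝ, 0 < C₁ ∧ 0 < C₂ ∧ ∀ H : ℝ, 2 ≤ H →
      (symmPairs n (c * H)).Finite ∧
      (2 ≤ c * H →
        C₁ * H ^ (((n : ℝ) ^ 2 + n) / 2) ≤ ((symmPairs n (c * H)).ncard : ℝ)) ∧
      ((symmPairs n (c * H)).ncard : ℝ) ≤ C₂ * (H ^ (n ^ 2) * Real.log H ^ (2 + n)) := by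
  have hn' : (0 : ℝ) < n := by exact_mod_cast hn
  have hlog2 : 0 < Real.log 2 := Real.log_pos one_lt_two
  -- `D` absorbs the additive constants into a multiple of `log H`, using `log H ≥ log 2`.
  set D := 8 * n * (|Real.log (n * c)| / Real.log 2 + 1) + 3 / Real.log 2 with hD
  have hD0 : 0 < D := by positivity
  refine ⟨(c / 6) ^ (n + 1).choose 2, D / Real.log 2 ^ (n + 1) * 2 ^ n * (3 * c) ^ (n ^ 2),
    by positivity, by positivity, fun H hH => ⟨symmPairs_finite n _, fun hcH => ?_, ?_⟩⟩
  · have hexp : ((n : ℝ) ^ 2 + n) / 2 = ((n + 1).choose 2 : ℕ) := by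
      rw [Nat.cast_choose_two]
      push_cast
      ring
    rw [hexp, Real.rpow_natCast, ← mul_pow]
    calc (c / 6 * H) ^ (n + 1).choose 2 = (c * H / 6) ^ (n + 1).choose 2 := by ring
      _ ≤ _ := le_ncard_symmPairs hn hcH
  · have hH0 : 0 < H := by linarith
    have hlogH : Real.log 2 ≤ Real.log H := Real.log_le_log two_pos hH
    have hlogH0 : 0 < Real.log H := hlog2.trans_le hlogH
    -- Heights are at least 1, so there are no pairs when `c * H < 1`.
    rcases lt_or_ge (c * H) 1 with h1 | h1
    · rw [symmPairs_eq_empty h1, Set.ncard_empty, Nat.cast_zero]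
      positivity
    · have hle : ∀ x : ℝ, 0 ≤ x → x ≤ x / Real.log 2 * Real.log H := by
        intro x hx
        rw [div_mul_eq_mul_div, le_div_iff₀ hlog2]
        exact mul_le_mul_of_nonneg_left hlogH hx
      have hlin : 8 * n * Real.log (n * (c * H)) + 3 ≤ D * Real.log H := by
        rw [← mul_assoc, Real.log_mul (by positivity) hH0.ne']
        have h2 : Real.log (n * c) + Real.log H ≤
            (|Real.log (n * c)| / Real.log 2 + 1) * Real.log H := by
          linarith [le_abs_self (Real.log (n * c)), hle _ (abs_nonneg (Real.log (n * c)))]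
        have h3 := mul_le_mul_of_nonneg_left h2 (by positivity : (0 : ℝ) ≤ 8 * n)
        have h4 := hle 3 (by norm_num)
        rw [hD]
        linarith
      -- A single logarithm is needed; the other `n + 1` are introduced at the cost of powers of
      -- `log 2`.
      have hpow : Real.log H ≤ Real.log H ^ (2 + n) / Real.log 2 ^ (n + 1) := by
        rw [le_div_iff₀ (by positivity)]
        calc Real.log H * Real.log 2 ^ (n + 1) ≤ Real.log H * Real.log H ^ (n + 1) := by gcongr
          _ = _ := by ring
      calc ((symmPairs n (c * H)).ncard : ℝ)
          ≤ (8 * n * Real.log (n * (c * H)) + 3) * 2 ^ n * (3 * (c * H)) ^ (n ^ 2) :=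
            ncard_symmPairs_le_mul_log hn h1
        _ ≤ (D * (Real.log H ^ (2 + n) / Real.log 2 ^ (n + 1))) * 2 ^ n *
              (3 * (c * H)) ^ (n ^ 2) := by
            gcongr
            exact hlin.trans (mul_le_mul_of_nonneg_left hpow hD0.le)
        _ = _ := by
            rw [← mul_assoc 3 c H, mul_pow (3 * c) H]
            ring
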